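/- Throughout, a nondeterministic one-tape off-line Turing machine $M$ with finite input alphabet $\Sigma$ has a finite set of states, with an initial state and with accepting and rejecting states, in which the computation stops, and a single semi-infinite tape, on whose leftmost squares the input string is written at the beginning; all other squares are then blank, and the head is on the leftmost square. At each move the machine, depending nondeterministically on its state and on the scanned symbol, writes a nonblank symbol of its finite tape alphabet on the scanned square (the blank is never written), enters a new state, and moves its head by one square to the left or to the right or keeps it stationary. An accepting computation on $x$ is a finite computation which starts in the initial configuration on $x$ and ends in an accepting state, and the language $L\subseteq\Sigma^*$ accepted by $M$ is the set of the strings which have an accepting computation. The crossing sequence of a computation $\mathcal C$ at a boundary between two adjacent squares is the sequence of the states in which the head crosses this boundary during $\mathcal C$, and $c(\mathcal C)$ denotes the length of the longest crossing sequence of $\mathcal C$. Under the weak measure, the length of the crossing sequences used by $M$ on the input $x$ is \[c_M(x)=\begin{cases}\min\{c(\mathcal C)\mid \mathcal C\text{ is an accepting computation on }x\}&\text{if }x\in L,\\ 0&\text{otherwise,}\end{cases}\] and on inputs of length $n$ it is $c_M(n)=\max\{c_M(x)\mid x\in\Sigma^*,\ |x|=n\}$. Theorem. Let $M$ be a nondeterministic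 one-tape off-line Turing machine which uses crossing sequences of length at most $c(n)$ under the weak measure, that is, $c_M(n)\le c(n)$ for every $n$. If $c(n)=o(\log\log n)$, then the language accepted by $M$ is regular. -/

import Mathlib

/-- The possible head movements of a machine. -/
inductive HeadMove : Type
  | left
  | stay
  | right

/-- `m.Moves h h'`: a head on square `h` of a tape with squares `0, 1, 2, …` is on square `h'`
after the movement `m`.  There is no way to move left from the leftmost square `0`. -/
def HeadMove.Moves : HeadMove → ℕ → ℕ → Prop
  | .left, h, h' => h = h' + 1
  | .stay, h, h' => h' = h
  | .right, h, h' => h' = h + 1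

/-- A nondeterministic one-tape off-line Turing machine with input alphabet `α`, set of states `Q`
and nonblank tape symbols `Γ`.  The content of a square is an element of `Option Γ`, where `none`
is the blank; the written symbol lies in `Γ`, so the machine never writes the blank. -/
structure OneTapeNTM (α Γ Q : Type*) where
  /-- input symbols are nonblank tape symbols -/
  input : α ↪ Γ
  /-- the initial state -/
  start : Q
  /-- the accepting states -/
  accepting : Set Q
  /-- the rejecting states -/
  rejecting : Set Q
  /-- no state is both accepting and rejecting -/
  disjoint : Disjoint accepting rejecting
  /-- the transition function: state and scanned content are mapped to the set of possible
  triples (new state, written symbol, head movement) -/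
  trans : Q → Option Γ → Set (Q × Γ × HeadMove)

namespace OneTapeNTM

/-- Configurations: current state, position of the head, content of the semi-infinite tape. -/
structure Cfg (Γ Q : Type*) where
  state : Q
  head : ℕ
  tape : ℕ → Option Γ

variable {α Γ Q : Type*}

/-- The initial configuration: the input starts at the leftmost square, where also the head is;
all the other squares are blank. -/
def init (M : OneTapeNTM α Γ Q) (x : List α) : Cfg Γ Q where
  state := M.start
  head := 0
  tape i := (x[i]?).map M.input

/-- One move of the machine.  There is none from an accepting or a rejecting state. -/
def Step (M : OneTapeNTM α Γ Q) (C D : Cfg Γ Q) : Prop :=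
  C.state ∉ M.accepting ∧ C.state ∉ M.rejecting ∧
    ∃ (g : Γ) (m : HeadMove), (D.state, g, m) ∈ M.trans C.state (C.tape C.head) ∧
      m.Moves C.head D.head ∧ D.tape = Function.update C.tape C.head (some g)

/-- The list `l` of configurations is an accepting computation of `M` on the input `x`. -/
def IsAcceptingComputation (M : OneTapeNTM α Γ Q) (x : List α) (l : List (Cfg Γ Q)) : Prop :=
  l.head? = some (M.init x) ∧ l.IsChain M.Step ∧ ∃ C ∈ l.getLast?, C.state ∈ M.accepting

/-- The language accepted by `M`. -/
def language (M : OneTapeNTM α Γ Q) : Language α :=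
  {x | ∃ l, M.IsAcceptingComputation x l}

/-- The crossing sequence of a computation at the boundary between the squares `b` and `b + 1`:
the states entered by the moves in which the head crosses this boundary, in order. -/
def crossingSequence (b : ℕ) : List (Cfg Γ Q) → List Q
  | C :: D :: l =>
    if (C.head = b ∧ D.head = b + 1) ∨ (C.head = b + 1 ∧ D.head = b) then
      D.state :: crossingSequence b (D :: l)
    else crossingSequence b (D :: l)
  | _ => []

/-- The number of states in the longest crossing sequence of a computation. -/
noncomputable def crossingLength (l : List (Cfg Γ Q)) : ℕ :=
  ⨆ b : ℕ, (crossingSequence b l).length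

open Classical in
/-- The length of the crossing sequences used by `M` on the input `x` under the weak measure:
the minimum over the accepting computations on `x`, and `0` if `x` is not accepted. -/
noncomputable def weakCrossing (M : OneTapeNTM α Γ Q) (x : List α) : ℕ :=
  if x ∈ M.language then sInf {k | ∃ l, M.IsAcceptingComputation x l ∧ crossingLength l = k}
  else 0

/-- The length of the crossing sequences used by `M` on inputs of length `n` under the weak
measure: the maximum over all inputs of length `n`. -/
noncomputable def weakCrossingLength (M : OneTapeNTM α Γ Q) (n : ℕ) : ℕ :=
  sSup {k | ∃ x : List α, x.length = n ∧ M.weakCrossing x = k}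

/-! The suprema and the infimum above are never taken over unbounded or empty sets. -/

theorem length_crossingSequence_le (b : ℕ) (l : List (Cfg Γ Q)) :
    (crossingSequence b l).length ≤ l.length := by
  fun_induction crossingSequence b l with
  | case1 C D l h ih => simp only [List.length_cons] at ih ⊢; omega
  | case2 C D l h ih => simp only [List.length_cons] at ih ⊢; omega
  | case3 => simp

theorem crossingLength_le_iff (l : List (Cfg Γ Q)) (k : ℕ) :
    crossingLength l ≤ k ↔ ∀ b, (crossingSequence b l).length ≤ k := by
  have h : BddAbove (Set.range fun b : ℕ => (crossingSequence b l).length) :=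
    ⟨l.length, by rintro _ ⟨b, rfl⟩; exact length_crossingSequence_le b l⟩
  exact ciSup_le_iff h

theorem weakCrossing_le_iff (M : OneTapeNTM α Γ Q) {x : List α} (hx : x ∈ M.language) (k : ℕ) :
    M.weakCrossing x ≤ k ↔ ∃ l, M.IsAcceptingComputation x l ∧ crossingLength l ≤ k := by
  have hne : {k | ∃ l, M.IsAcceptingComputation x l ∧ crossingLength l = k}.Nonempty := by
    obtain ⟨l, hl⟩ := hx
    exact ⟨_, l, hl, rfl⟩
  rw [weakCrossing, if_pos hx]
  constructor
  · intro h
    obtain ⟨l, hl, e⟩ := Nat.sInf_mem hne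
    exact ⟨l, hl, e.trans_le h⟩
  · rintro ⟨l, hl, h⟩
    have hl' : crossingLength l ∈
        {k | ∃ l, M.IsAcceptingComputation x l ∧ crossingLength l = k} := ⟨l, hl, rfl⟩
    exact (Nat.sInf_le hl').trans h

theorem weakCrossing_le_weakCrossingLength [Finite α] (M : OneTapeNTM α Γ Q) (x : List α) :
    M.weakCrossing x ≤ M.weakCrossingLength x.length := by
  refine le_csSup (Set.Finite.bddAbove ?_) ⟨x, rfl, rfl⟩
  exact (List.finite_length_eq α x.length).image M.weakCrossing

end OneTapeNTM

/-! ### Cut and paste of computations -/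

namespace OneTapeNTM

variable {α Γ Q : Type*}

/-! For fixed `K`, let `L_K` be the set of strings accepted with crossing sequences of length at
most `K`. Computations with equal crossing sequences at two boundaries can be spliced
(`exists_splice`), so the left quotient of `L_K` by a nonempty prefix depends only on the set of
crossing sequences possible at its end. There are finitely many such sets, hence `L_K` is regular.
If the union `L` of the `L_K` is not regular, then `L_(K+1)` properly contains `L_K` for arbitrarily
large `K`. A shortest string `x` in the difference has no two prefixes with the same sets for both
`K` and `K + 1`, so its length is at most doubly exponential in `K`. Since `x` needs crossing
sequences of length `K + 1`, the crossing length is not `o(log log n)`. -/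

/-- `D` agrees with `D₁` on the squares up to `b₁`, and to the right of `b₁` it agrees with the part
of `D₂` to the right of `b₂`; the heads of all three are on the same side. -/
def Splice (b₁ b₂ : ℕ) (D₁ D₂ D : Cfg Γ Q) : Prop :=
  (∀ i ≤ b₁, D.tape i = D₁.tape i) ∧ (∀ j, D.tape (b₁ + 1 + j) = D₂.tape (b₂ + 1 + j)) ∧
    ((D₁.head ≤ b₁ ∧ D₂.head ≤ b₂ ∧ D.head = D₁.head ∧ D.state = D₁.state) ∨
      (b₁ < D₁.head ∧ b₂ < D₂.head ∧ D.head + b₂ = D₂.head + b₁ ∧ D.state = D₂.state))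

theorem crossingSequence_cons_cons (b : ℕ) (C D : Cfg Γ Q) (l : List (Cfg Γ Q)) :
    crossingSequence b (C :: D :: l) =
      if (C.head = b ∧ D.head = b + 1) ∨ (C.head = b + 1 ∧ D.head = b) then
        D.state :: crossingSequence b (D :: l)
      else crossingSequence b (D :: l) := by
  rw [crossingSequence]

theorem Step.head_le {M : OneTapeNTM α Γ Q} {C D : Cfg Γ Q} (h : M.Step C D) :
    D.head ≤ C.head + 1 ∧ C.head ≤ D.head + 1 := by
  obtain ⟨-, -, g, m, -, hm, -⟩ := h
  cases m <;> simp only [HeadMove.Moves] at hm <;> omega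

theorem Step.tape_of_ne {M : OneTapeNTM α Γ Q} {C D : Cfg Γ Q} (h : M.Step C D) {i : ℕ}
    (hi : i ≠ C.head) : D.tape i = C.tape i := by
  obtain ⟨-, -, g, m, -, -, ht⟩ := h
  rw [ht, Function.update_of_ne hi]

/-- A step can be performed in any configuration with the same state and the same scanned
content. -/
theorem Step.transfer {M : OneTapeNTM α Γ Q} {C C' D : Cfg Γ Q} (h : M.Step C C') {h' : ℕ}
    (hs : D.state = C.state) (ht : D.tape D.head = C.tape C.head)
    (hh : D.head + C'.head = C.head + h') :
    M.Step D ⟨C'.state, h', Function.update D.tape D.head (C'.tape C.head)⟩ := by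
  obtain ⟨ha, hr, g, m, htr, hm, e⟩ := h
  refine ⟨hs ▸ ha, hs ▸ hr, g, m, ?_, ?_, ?_⟩
  · rw [hs, ht]; exact htr
  · cases m <;> simp only [HeadMove.Moves] at hm ⊢ <;> omega
  · simp [e]

/-- Two computations with the same crossing sequence at `b₁` and `b₂`, respectively, can be
combined. -/
theorem exists_splice (M : OneTapeNTM α Γ Q) (b₁ b₂ n : ℕ) :
    ∀ (l₁ l₂ : List (Cfg Γ Q)) (D₁ D₂ D : Cfg Γ Q), l₁.length + l₂.length ≤ n →
      List.IsChain M.Step (D₁ :: l₁) → List.IsChain M.Step (D₂ :: l₂) →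
      (∃ C ∈ (D₁ :: l₁).getLast?, C.state ∈ M.accepting) →
      (∃ C ∈ (D₂ :: l₂).getLast?, C.state ∈ M.accepting) →
      crossingSequence b₁ (D₁ :: l₁) = crossingSequence b₂ (D₂ :: l₂) →
      Splice b₁ b₂ D₁ D₂ D →
      ∃ l, List.IsChain M.Step (D :: l) ∧ (∃ C ∈ (D :: l).getLast?, C.state ∈ M.accepting) ∧
        (∀ b < b₁, (crossingSequence b (D :: l)).length ≤
          (crossingSequence b (D₁ :: l₁)).length) ∧
        (∀ j, (crossingSequence (b₁ + j) (D :: l)).length ≤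
          (crossingSequence (b₂ + j) (D₂ :: l₂)).length) := by
  -- The induction is on the total length, since either computation may advance while the other
  -- waits.
  induction n with
  | zero =>
    intro l₁ l₂ D₁ D₂ D hn _ _ a₁ a₂ _ hS
    obtain rfl : l₁ = [] := List.eq_nil_of_length_eq_zero (by omega)
    obtain rfl : l₂ = [] := List.eq_nil_of_length_eq_zero (by omega)
    refine ⟨[], by simp, ?_, by simp [crossingSequence], by simp [crossingSequence]⟩
    obtain ⟨-, -, ⟨-, -, -, h⟩ | ⟨-, -, -, h⟩⟩ := hS <;> simp_all
  | succ n ih =>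
    intro l₁ l₂ D₁ D₂ D hn c₁ c₂ a₁ a₂ hcs hS
    obtain ⟨hL, hR, hside⟩ := hS
    -- Both computations cross at the same move, in the same direction; only here does control of
    -- the spliced computation change sides.
    have both : ∀ E₁ l₁' E₂ l₂' (E : Cfg Γ Q), l₁ = E₁ :: l₁' → l₂ = E₂ :: l₂' →
        M.Step D E → Splice b₁ b₂ E₁ E₂ E →
        ((D.head = b₁ ∧ D₂.head = b₂ ∧ D₁.head = b₁ ∧
          E.head = b₁ + 1 ∧ E₂.head = b₂ + 1 ∧ E₁.head = b₁ + 1) ∨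
         (D.head = b₁ + 1 ∧ D₂.head = b₂ + 1 ∧ D₁.head = b₁ + 1 ∧
          E.head = b₁ ∧ E₂.head = b₂ ∧ E₁.head = b₁)) →
        ∃ l, List.IsChain M.Step (D :: l) ∧
        (∃ C ∈ (D :: l).getLast?, C.state ∈ M.accepting) ∧
        (∀ b < b₁, (crossingSequence b (D :: l)).length ≤
          (crossingSequence b (D₁ :: l₁)).length) ∧
        (∀ j, (crossingSequence (b₁ + j) (D :: l)).length ≤
          (crossingSequence (b₂ + j) (D₂ :: l₂)).length) := by
      rintro E₁ l₁' E₂ l₂' E rfl rfl hst hS hh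
      rw [crossingSequence_cons_cons, crossingSequence_cons_cons, if_pos (by omega),
        if_pos (by omega)] at hcs
      simp only [List.length_cons] at hn
      rw [List.isChain_cons_cons] at c₁ c₂
      obtain ⟨l, hl, ha, h₁, h₂⟩ := ih l₁' l₂' E₁ E₂ E (by omega) c₁.2 c₂.2
        (by simpa using a₁) (by simpa using a₂) (List.cons.inj hcs).2 hS
      refine ⟨E :: l, List.isChain_cons_cons.2 ⟨hst, hl⟩, by simpa using ha, ?_, ?_⟩
      · intro b hb
        rw [crossingSequence_cons_cons, crossingSequence_cons_cons, if_neg (by omega),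
          if_neg (by omega)]
        exact h₁ b hb
      · intro j
        have := h₂ j
        rw [crossingSequence_cons_cons, crossingSequence_cons_cons]
        split_ifs <;> first | omega | (simp only [List.length_cons]; omega)
    rcases hside with ⟨s₁, s₂, hh, hs⟩ | ⟨s₁, s₂, hh, hs⟩
    · cases l₁ with
      | nil =>
        exact ⟨[], by simp, by simpa [hs] using a₁, by simp [crossingSequence],
          by simp [crossingSequence]⟩
      | cons E₁ l₁ =>
        have c₁' := List.isChain_cons_cons.1 c₁
        have hst := c₁'.1.transfer (D := D) (h' := E₁.head) hs (by rw [hh]; exact hL _ s₁)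
          (by omega)
        have hmv := c₁'.1.head_le
        have htp : ∀ i ≤ b₁, Function.update D.tape D.head (E₁.tape D₁.head) i = E₁.tape i := by
          intro i hi
          rcases eq_or_ne i D₁.head with rfl | hne
          · simp [hh]
          · rw [Function.update_of_ne (by omega), c₁'.1.tape_of_ne hne, hL i hi]
        by_cases hE : E₁.head ≤ b₁
        · rw [crossingSequence_cons_cons, if_neg (by omega)] at hcs
          simp only [List.length_cons] at hn
          obtain ⟨l, hl, ha, h₁, h₂⟩ := ih l₁ l₂ E₁ D₂
            ⟨E₁.state, E₁.head, Function.update D.tape D.head (E₁.tape D₁.head)⟩ (by omega) c₁'.2 c₂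
            (by simpa using a₁) a₂ hcs
            ⟨htp, fun j => by dsimp only; rw [Function.update_of_ne (by omega), hR],
              Or.inl ⟨hE, s₂, rfl, rfl⟩⟩
          refine ⟨_, List.isChain_cons_cons.2 ⟨hst, hl⟩, by simpa using ha, ?_, ?_⟩
          · intro b hb
            have := h₁ b hb
            rw [crossingSequence_cons_cons, crossingSequence_cons_cons]
            dsimp only
            split_ifs <;> first | omega | (simp only [List.length_cons]; omega)
          · intro j
            rw [crossingSequence_cons_cons, if_neg (by dsimp only; omega)]
            exact h₂ j
        -- The first computation is about to cross, so the second has a crossing left as well. Until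
        -- it comes, the second advances alone on its left part, and the spliced computation stands
        -- still.
        · cases l₂ with
          | nil =>
            rw [crossingSequence_cons_cons, if_pos (by omega)] at hcs
            simp [crossingSequence] at hcs
          | cons E₂ l₂ =>
            have c₂' := List.isChain_cons_cons.1 c₂
            have hmv₂ := c₂'.1.head_le
            by_cases hE₂ : E₂.head ≤ b₂
            · rw [crossingSequence_cons_cons (b := b₂), if_neg (by omega)] at hcs
              simp only [List.length_cons] at hn
              obtain ⟨l, hl, ha, h₁, h₂⟩ := ih (E₁ :: l₁) l₂ D₁ E₂ D
                (by simp only [List.length_cons]; omega) c₁ c₂'.2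
                a₁ (by simpa using a₂) hcs
                ⟨hL, fun j => by rw [hR, c₂'.1.tape_of_ne (by omega)],
                  Or.inl ⟨s₁, hE₂, hh, hs⟩⟩
              refine ⟨l, hl, ha, h₁, ?_⟩
              intro j
              rw [crossingSequence_cons_cons, if_neg (by omega)]
              exact h₂ j
            · have hst' : E₁.state = E₂.state := by
                rw [crossingSequence_cons_cons, crossingSequence_cons_cons, if_pos (by omega),
                  if_pos (by omega)] at hcs
                exact (List.cons.inj hcs).1
              refine both E₁ l₁ E₂ l₂ _ rfl rfl hst ⟨htp, fun j => ?_,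
                Or.inr ⟨by omega, by omega, by dsimp only; omega, hst'⟩⟩
                (Or.inl ⟨by omega, by omega, by omega, by dsimp only; omega, by omega, by omega⟩)
              dsimp only
              rw [Function.update_of_ne (by omega), hR, c₂'.1.tape_of_ne (by omega)]
    · cases l₂ with
      | nil =>
        exact ⟨[], by simp, by simpa [hs] using a₂, by simp [crossingSequence],
          by simp [crossingSequence]⟩
      | cons E₂ l₂ =>
        have c₂' := List.isChain_cons_cons.1 c₂
        have hmv := c₂'.1.head_le
        obtain ⟨k, hk⟩ := Nat.exists_eq_add_of_lt s₂
        have hkD : D.head = b₁ + 1 + k := by omega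
        have hst := c₂'.1.transfer (D := D) (h' := E₂.head + b₁ - b₂) hs
          (by rw [hkD, hR]; congr 1; omega) (by omega)
        have htp : ∀ j, Function.update D.tape D.head (E₂.tape D₂.head) (b₁ + 1 + j) =
            E₂.tape (b₂ + 1 + j) := by
          intro j
          rcases eq_or_ne j k with rfl | hne
          · rw [hkD, Function.update_self]; congr 1; omega
          · rw [Function.update_of_ne (by omega), c₂'.1.tape_of_ne (by omega), hR]
        by_cases hE : b₂ < E₂.head
        · rw [crossingSequence_cons_cons (b := b₂), if_neg (by omega)] at hcs
          simp only [List.length_cons] at hn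
          obtain ⟨l, hl, ha, h₁, h₂⟩ := ih l₁ l₂ D₁ E₂
            ⟨E₂.state, E₂.head + b₁ - b₂, Function.update D.tape D.head (E₂.tape D₂.head)⟩ (by omega) c₁ c₂'.2
            a₁ (by simpa using a₂) hcs
            ⟨fun i hi => by dsimp only; rw [Function.update_of_ne (by omega), hL i hi], htp,
              Or.inr ⟨s₁, hE, by dsimp only; omega, rfl⟩⟩
          refine ⟨_, List.isChain_cons_cons.2 ⟨hst, hl⟩, by simpa using ha, ?_, ?_⟩
          · intro b hb
            rw [crossingSequence_cons_cons, if_neg (by dsimp only; omega)]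
            exact h₁ b hb
          · intro j
            have := h₂ j
            rw [crossingSequence_cons_cons, crossingSequence_cons_cons]
            dsimp only
            split_ifs <;> first | omega | (simp only [List.length_cons]; omega)
        · cases l₁ with
          | nil =>
            rw [crossingSequence_cons_cons (b := b₂), if_pos (by omega)] at hcs
            simp [crossingSequence] at hcs
          | cons E₁ l₁ =>
            have c₁' := List.isChain_cons_cons.1 c₁
            have hmv₁ := c₁'.1.head_le
            by_cases hE₁ : b₁ < E₁.head
            · rw [crossingSequence_cons_cons, if_neg (by omega)] at hcs
              simp only [List.length_cons] at hn
              obtain ⟨l, hl, ha, h₁, h₂⟩ := ih l₁ (E₂ :: l₂) E₁ D₂ D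
                (by simp only [List.length_cons]; omega) c₁'.2 c₂
                (by simpa using a₁) a₂ hcs
                ⟨fun i hi => by rw [hL i hi, c₁'.1.tape_of_ne (by omega)], hR,
                  Or.inr ⟨hE₁, s₂, hh, hs⟩⟩
              refine ⟨l, hl, ha, ?_, h₂⟩
              intro b hb
              rw [crossingSequence_cons_cons, if_neg (by omega)]
              exact h₁ b hb
            · have hst' : E₁.state = E₂.state := by
                rw [crossingSequence_cons_cons, crossingSequence_cons_cons, if_pos (by omega),
                  if_pos (by omega)] at hcs
                exact (List.cons.inj hcs).1
              refine both E₁ l₁ E₂ l₂ _ rfl rfl hst ⟨fun i hi => ?_, htp,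
                Or.inl ⟨by omega, by omega, by dsimp only; omega, hst'.symm⟩⟩
                (Or.inr ⟨by omega, by omega, by omega, by dsimp only; omega, by omega, by omega⟩)
              dsimp only
              rw [Function.update_of_ne (by omega), hL i hi, c₁'.1.tape_of_ne (by omega)]

/-! ### Languages of bounded crossing length -/

/-- The strings with an accepting computation whose crossing sequences have length at most `K`. -/
def boundedLanguage (M : OneTapeNTM α Γ Q) (K : ℕ) : Language α :=
  {x | ∃ l, M.IsAcceptingComputation x l ∧ crossingLength l ≤ K}

/-- The crossing sequences, of length at most `K` and padded by `none`, at the right end of the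
prefix `u` in accepting computations whose crossing sequences have length at most `K`. -/
def prefixCrossings (M : OneTapeNTM α Γ Q) (K : ℕ) (u : List α) : Set (Fin K → Option Q) :=
  {f | ∃ v l, M.IsAcceptingComputation (u ++ v) l ∧ crossingLength l ≤ K ∧
    f = fun i : Fin K => (crossingSequence (u.length - 1) l)[(i : ℕ)]?}

theorem isAcceptingComputation_cons_iff {M : OneTapeNTM α Γ Q} {x : List α} {D : Cfg Γ Q}
    {l : List (Cfg Γ Q)} : M.IsAcceptingComputation x (D :: l) ↔
      D = M.init x ∧ List.IsChain M.Step (D :: l) ∧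
        ∃ C ∈ (D :: l).getLast?, C.state ∈ M.accepting := by
  simp [IsAcceptingComputation]

/-- The inclusion supplies a computation on some `u' ++ v'` with the crossing sequence that the
given computation on `u ++ v` has at the end of `u`. Its left part is spliced with the right part of
the given one. Nonemptiness ensures that a boundary exists at the end of each prefix. -/
theorem append_mem_boundedLanguage (M : OneTapeNTM α Γ Q) {K : ℕ} {u u' v : List α}
    (hu : u ≠ []) (hu' : u' ≠ []) (h : M.prefixCrossings K u ⊆ M.prefixCrossings K u')
    (hx : u ++ v ∈ M.boundedLanguage K) : u' ++ v ∈ M.boundedLanguage K := by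
  obtain ⟨l₂, hl₂, hK₂⟩ := hx
  obtain ⟨v', l₁, hl₁, hK₁, hcs⟩ := h ⟨v, l₂, hl₂, hK₂, rfl⟩
  have hu := List.length_pos_iff.2 hu
  have hu' := List.length_pos_iff.2 hu'
  rw [crossingLength_le_iff] at hK₁ hK₂
  have hcs : crossingSequence (u'.length - 1) l₁ = crossingSequence (u.length - 1) l₂ := by
    refine List.ext_getElem? fun i => ?_
    by_cases hi : i < K
    · exact (congrFun hcs ⟨i, hi⟩).symm
    · rw [List.getElem?_eq_none ((hK₁ _).trans (by omega)),
        List.getElem?_eq_none ((hK₂ _).trans (by omega))]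
  cases l₁ with
  | nil => simp [IsAcceptingComputation] at hl₁
  | cons D₁ l₁ =>
  cases l₂ with
  | nil => simp [IsAcceptingComputation] at hl₂
  | cons D₂ l₂ =>
  rw [isAcceptingComputation_cons_iff] at hl₁ hl₂
  obtain ⟨rfl, c₁, a₁⟩ := hl₁
  obtain ⟨rfl, c₂, a₂⟩ := hl₂
  obtain ⟨l, hl, ha, h₁, h₂⟩ := M.exists_splice _ _ _ l₁ l₂ _ _ (M.init (u' ++ v)) le_rfl c₁ c₂
    a₁ a₂ hcs (by
      refine ⟨fun i hi => ?_, fun j => ?_, Or.inl ⟨?_, ?_, rfl, rfl⟩⟩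
      · simp only [init]
        rw [List.getElem?_append_left (by omega), List.getElem?_append_left (by omega)]
      · simp only [init]
        rw [List.getElem?_append_right (by omega), List.getElem?_append_right (by omega)]
        congr 2; omega
      · simp [init]
      · simp [init])
  refine ⟨_, isAcceptingComputation_cons_iff.2 ⟨rfl, hl, ha⟩, ?_⟩
  rw [crossingLength_le_iff]
  intro b
  by_cases hb : b < u'.length - 1
  · exact (h₁ b hb).trans (hK₁ b)
  · obtain ⟨j, rfl⟩ := Nat.exists_eq_add_of_le (not_lt.1 hb)
    exact (h₂ j).trans (hK₂ _)

theorem boundedLanguage_isRegular [Finite Q] (M : OneTapeNTM α Γ Q) (K : ℕ) :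
    (M.boundedLanguage K).IsRegular := by
  rw [Language.isRegular_iff_finite_range_leftQuotient]
  have key : ∀ u u' : List α, u ≠ [] → u' ≠ [] → M.prefixCrossings K u = M.prefixCrossings K u' →
      (M.boundedLanguage K).leftQuotient u = (M.boundedLanguage K).leftQuotient u' := by
    intro u u' hu hu' h
    ext v
    exact ⟨M.append_mem_boundedLanguage hu hu' h.le, M.append_mem_boundedLanguage hu' hu h.ge⟩
  have hfin : (Set.range fun u : {u : List α // u ≠ []} =>
      (M.boundedLanguage K).leftQuotient u.1).Finite := by
    -- `epsilon` picks a representative prefix for each set of crossing sequences.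
    refine Set.Finite.of_surjOn (s := Set.univ)
      (f := fun S : Set (Fin K → Option Q) => (M.boundedLanguage K).leftQuotient
        (Classical.epsilon fun u => u ≠ [] ∧ M.prefixCrossings K u = S)) ?_ Set.finite_univ
    rintro _ ⟨⟨u, hu⟩, rfl⟩
    refine ⟨M.prefixCrossings K u, trivial, ?_⟩
    have := Classical.epsilon_spec
      (p := fun u' => u' ≠ [] ∧ M.prefixCrossings K u' = M.prefixCrossings K u) ⟨u, hu, rfl⟩
    exact key _ _ this.1 hu this.2
  refine (hfin.insert ((M.boundedLanguage K).leftQuotient [])).subset ?_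
  rintro _ ⟨u, rfl⟩
  by_cases hu : u = []
  · exact Or.inl (by rw [hu])
  · exact Or.inr ⟨⟨u, hu⟩, rfl⟩

/-! ### Growth of the bounded languages -/

/-- A shortest string separating two consecutive bounded languages is at most doubly exponentially
long. -/
theorem exists_short_separating [Finite Q] (M : OneTapeNTM α Γ Q) (K : ℕ)
    (h : ∃ x ∈ M.boundedLanguage (K + 1), x ∉ M.boundedLanguage K) :
    ∃ x ∈ M.boundedLanguage (K + 1), x ∉ M.boundedLanguage K ∧
      x.length ≤ 2 ^ (Nat.card Q + 1) ^ (K + 2) := by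
  classical
  have hex : ∃ n, ∃ x ∈ M.boundedLanguage (K + 1), x ∉ M.boundedLanguage K ∧ x.length = n := by
    obtain ⟨x, h₁, h₂⟩ := h
    exact ⟨_, x, h₁, h₂, rfl⟩
  obtain ⟨x, hx, hx', hxn⟩ := Nat.find_spec hex
  refine ⟨x, hx, hx', ?_⟩
  by_contra! hlen
  -- Equal second components keep the shortened string in the larger language, equal first
  -- components keep it out of the smaller one.
  let f : Fin x.length → Set (Fin K → Option Q) × Set (Fin (K + 1) → Option Q) := fun i =>
    (M.prefixCrossings K (x.take (i + 1)), M.prefixCrossings (K + 1) (x.take (i + 1)))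
  have hf : ¬ Function.Injective f := by
    intro hf
    have := Nat.card_le_card_of_injective f hf
    have := Fintype.ofFinite Q
    simp only [Nat.card_eq_fintype_card, Fintype.card_fin, Fintype.card_prod, Fintype.card_set,
      Fintype.card_fun, Fintype.card_option, ← pow_add] at *
    have hq : 0 < Fintype.card Q := Fintype.card_pos_iff.2 ⟨M.start⟩
    -- With `r = card Q + 1 ≥ 2`, this is `1 + r ≤ r ^ 2`.
    have hle : (Fintype.card Q + 1) ^ K + (Fintype.card Q + 1) ^ (K + 1) ≤
        (Fintype.card Q + 1) ^ (K + 2) := by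
      rw [pow_succ, pow_succ, pow_succ, mul_assoc, ← mul_one_add]
      exact Nat.mul_le_mul_left _ (by nlinarith)
    have := Nat.pow_le_pow_right (n := 2) (by omega) hle
    omega
  obtain ⟨i, j, hij, hne⟩ := Function.not_injective_iff.1 hf
  wlog hlt : i < j generalizing i j
  · exact this j i hij.symm hne.symm (lt_of_le_of_ne (not_lt.1 hlt) hne.symm)
  have hj := j.2
  have hlt' : (i : ℕ) < j := hlt
  have hi0 : x.take (i + 1) ≠ [] := by
    rw [← List.length_pos_iff, List.length_take]; omega
  have hj0 : x.take (j + 1) ≠ [] := by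
    rw [← List.length_pos_iff, List.length_take]; omega
  obtain ⟨e, e'⟩ := Prod.mk.inj hij
  refine Nat.find_min hex (m := (x.take (i + 1) ++ x.drop (j + 1)).length) ?_
    ⟨x.take (i + 1) ++ x.drop (j + 1), ?_, ?_, rfl⟩
  · rw [← hxn]
    simp only [List.length_append, List.length_take, List.length_drop]
    omega
  · refine M.append_mem_boundedLanguage hj0 hi0 e'.ge ?_
    rwa [List.take_append_drop]
  · intro hmem
    have := M.append_mem_boundedLanguage hi0 hj0 e.le hmem
    rw [List.take_append_drop] at this
    exact hx' this

theorem boundedLanguage_mono (M : OneTapeNTM α Γ Q) {K K' : ℕ} (h : K ≤ K') :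
    M.boundedLanguage K ≤ M.boundedLanguage K' :=
  fun _ ⟨l, hl, hK⟩ => ⟨l, hl, hK.trans h⟩

theorem boundedLanguage_le_language (M : OneTapeNTM α Γ Q) (K : ℕ) :
    M.boundedLanguage K ≤ M.language :=
  fun _ ⟨l, hl, _⟩ => ⟨l, hl⟩

/-- The bounded languages of a machine with a nonregular language grow infinitely often. -/
theorem exists_mem_boundedLanguage_succ [Finite Q] (M : OneTapeNTM α Γ Q)
    (hM : ¬ M.language.IsRegular) (K₀ : ℕ) :
    ∃ K ≥ K₀, ∃ x ∈ M.boundedLanguage (K + 1), x ∉ M.boundedLanguage K := by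
  by_contra! hcon
  refine hM ?_
  have hle : ∀ d, M.boundedLanguage (K₀ + d) ≤ M.boundedLanguage K₀ := by
    intro d
    induction d with
    | zero => exact le_rfl
    | succ d ih => exact fun x hx => ih (hcon (K₀ + d) (by omega) x hx)
  have : M.language = M.boundedLanguage K₀ := by
    refine le_antisymm ?_ (M.boundedLanguage_le_language K₀)
    rintro x ⟨l, hl⟩
    exact hle (crossingLength l) (M.boundedLanguage_mono (by omega) ⟨l, hl, le_rfl⟩)
  rw [this]
  exact M.boundedLanguage_isRegular K₀

end OneTapeNTM

/-! ### Comparison with the iterated logarithm -/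

theorem theorem4 {α Γ Q : Type*} [Finite α] [Finite Γ] [Finite Q] (M : OneTapeNTM α Γ Q)
    (c : ℕ → ℝ) (hM : ∀ n : ℕ, (M.weakCrossingLength n : ℝ) ≤ c n)
    (hc : c =o[Filter.atTop] fun n : ℕ => Real.logb 2 (Real.logb 2 (n : ℝ))) :
    M.language.IsRegular := by
  by_contra hreg
  have : Nonempty Q := ⟨M.start⟩
  set r : ℕ := Nat.card Q + 1 with hr
  have hr2 : 2 ≤ r := by have := Nat.card_pos (α := Q); omega
  set C : ℝ := Real.logb 2 r with hC
  have hCpos : 0 < C := Real.logb_pos (by norm_num) (by exact_mod_cast hr2)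
  -- The factor 3 gives `(K + 2) / 3 < K + 1` for every `K`, including 0.
  have hev := hc.bound (c := 1 / (3 * C)) (by positivity)
  rw [Filter.eventually_atTop] at hev
  obtain ⟨n₀, hn₀⟩ := hev
  -- The sum dominates the crossing length on every input length below `n₀ + 2`, so a string needing
  -- more than `K₀` is longer; the 2 makes the iterated logarithm nonnegative.
  set K₀ : ℕ := ∑ n ∈ Finset.range (n₀ + 2), M.weakCrossingLength n with hK₀
  obtain ⟨K, hK, hsep⟩ := M.exists_mem_boundedLanguage_succ hreg K₀
  obtain ⟨x, hx, hx', hlen⟩ := M.exists_short_separating K hsep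
  have hxL := M.boundedLanguage_le_language _ hx
  have hlow : K < M.weakCrossingLength x.length := by
    refine lt_of_lt_of_le ?_ (M.weakCrossing_le_weakCrossingLength x)
    by_contra! h
    exact hx' ((M.weakCrossing_le_iff hxL K).1 h)
  have hbig : n₀ + 2 ≤ x.length := by
    by_contra! h
    have := Finset.single_le_sum (f := fun n => M.weakCrossingLength n) (fun _ _ => Nat.zero_le _)
      (Finset.mem_range.2 h)
    omega
  have hx2 : (2 : ℝ) ≤ x.length := by exact_mod_cast (by omega : 2 ≤ x.length)
  have hlog1 : 1 ≤ Real.logb 2 (x.length : ℝ) := by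
    rw [Real.le_logb_iff_rpow_le (by norm_num) (by linarith)]
    simpa using hx2
  have hloglog0 : 0 ≤ Real.logb 2 (Real.logb 2 (x.length : ℝ)) :=
    Real.logb_nonneg (by norm_num) hlog1
  have hlog : Real.logb 2 (x.length : ℝ) ≤ (r : ℝ) ^ (K + 2) := by
    rw [Real.logb_le_iff_le_rpow (by norm_num) (by linarith)]
    exact_mod_cast hlen
  have hloglog : Real.logb 2 (Real.logb 2 (x.length : ℝ)) ≤ (K + 2) * C := by
    refine (Real.logb_le_logb_of_le (by norm_num) (by linarith) hlog).trans_eq ?_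
    rw [Real.logb_pow]
    push_cast
    rfl
  have hb := hn₀ x.length (by omega)
  rw [Real.norm_of_nonneg hloglog0] at hb
  have h1 : (K + 1 : ℝ) ≤ c x.length :=
    le_trans (by exact_mod_cast hlow) (hM x.length)
  have h2 : c x.length ≤ (K + 2) / 3 :=
    calc c x.length ≤ ‖c x.length‖ := Real.le_norm_self _
      _ ≤ 1 / (3 * C) * ((K + 2) * C) := hb.trans (by gcongr)
      _ = (K + 2) / 3 := by field_simp
  have : (0 : ℝ) ≤ K := Nat.cast_nonneg K
  linarith
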